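/- For $p\in[0,1]$ let $|p\rangle=\sqrt p\,|0\rangle+\sqrt{1-p}\,|1\rangle$ (a "quoin"), and for $a\in[0,1]$ let $$H(a)=\begin{pmatrix}\sqrt{1-a}&\sqrt a\\ \sqrt a&-\sqrt{1-a}\end{pmatrix}.$$ Given $2\times2$ unitary matrices $U_1,\dots,U_n$ ($n$ finite), let $P_p$ be the probability measure on the space $\Omega_n=(\{0,1\}^{\mathbb N})^n$ of $n$-tuples of infinite binary sequences $(X_{i,j})$ under which all $X_{i,j}$ are independent and $P_p(X_{i,j}=v)=|\langle v|U_i|p\rangle|^2$; that is, $X_{i,j}$ is the outcome of a computational-basis measurement of the $j$-th quoin of the $i$-th stream after $U_i$ has been applied to it. A set $S\subseteq\Omega_n$ is *discernible* with respect to $P_p$ if almost surely finitely many outcomes decide whether $S$ occurs, i.e. $P_p(\operatorname{int}S)+P_p(\operatorname{int}S^{c})=1$, with interiors taken in the product topology. A function $f:[0,1]\to[0,1]$ is *constructible with quoins and finitely many single-qubit unitaries* from a class $\mathcal U$ if there are finitely many $U_1,\dots,U_n\in\mathcal U$ and an event $S\subseteq\Omega_n$, independent of $p$, such that for every $p\in[0,1]$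 the event $S$ is discernible with respect to $P_p$ and $P_p(S)=f(p)$. A function $f:[0,1]\to[0,1]$ is *simple and poly-bounded* if 1. $f$ is continuous; 2. $Z=\{z: f(z)=0\}$ and $W=\{w: f(w)=1\}$ are finite; 3. for every $z\in Z$ there are $c,\delta>0$ and an integer $k\ge 0$ such that $c(p-z)^{2k}\le f(p)$ for all $p\in[z-\delta,z+\delta]\cap[0,1]$; 4. for every $w\in W$ there are $c,\delta>0$ and an integer $k\ge 0$ such that $f(p)\le 1-c(p-w)^{2k}$ for all $p\in[w-\delta,w+\delta]\cap[0,1]$. **Theorem.** A function $f:[0,1]\to[0,1]$ is constructible with quoins and finitely many single-qubit unitaries if and only if $f$ is simple and poly-bounded or $f$ is one of the two trivial constant functions $f\equiv0$, $f\equiv1$. The same equivalence holds if only the unitaries $H(a)$, $a\in[0,1]$, may be used. -/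

import Mathlib

open MeasureTheory

noncomputable section

namespace QuantumBernoulli

/-- The quoin `|p⟩ = √p |0⟩ + √(1-p) |1⟩`, as a vector of amplitudes in the computational basis. -/
def quoin (p : unitInterval) : Fin 2 → ℂ :=
  ![((√(p : ℝ) : ℝ) : ℂ), ((√(1 - (p : ℝ)) : ℝ) : ℂ)]

/-- The matrix `H(a)`, with rows `(√(1-a), √a)` and `(√a, -√(1-a))`. -/
def hMatrix (a : unitInterval) : Matrix (Fin 2) (Fin 2) ℂ :=
  !![((√(1 - (a : ℝ)) : ℝ) : ℂ), ((√(a : ℝ) : ℝ) : ℂ);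
     ((√(a : ℝ) : ℝ) : ℂ), -((√(1 - (a : ℝ)) : ℝ) : ℂ)]

theorem hMatrix_mem (a : unitInterval) : hMatrix a ∈ Matrix.unitaryGroup (Fin 2) ℂ := by
  have h0 : (0 : ℝ) ≤ (a : ℝ) := a.2.1
  have h1 : (0 : ℝ) ≤ 1 - (a : ℝ) := sub_nonneg.2 a.2.2
  have e0 : ((√(a : ℝ) : ℝ) : ℂ) * ((√(a : ℝ) : ℝ) : ℂ) = ((a : ℝ) : ℂ) := by
    rw [← Complex.ofReal_mul, Real.mul_self_sqrt h0]
  have e1 : ((√(1 - (a : ℝ)) : ℝ) : ℂ) * ((√(1 - (a : ℝ)) : ℝ) : ℂ) = 1 - ((a : ℝ) : ℂ) := by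
    rw [← Complex.ofReal_mul, Real.mul_self_sqrt h1]; push_cast; rfl
  rw [Matrix.mem_unitaryGroup_iff]
  ext i j
  fin_cases i <;> fin_cases j <;>
    simp [hMatrix, Matrix.mul_apply, Matrix.star_apply, Fin.sum_univ_two, e0, e1, mul_comm]

/-- The single-qubit unitary `H(a)`. -/
def hGate (a : unitInterval) : Matrix.unitaryGroup (Fin 2) ℂ := ⟨hMatrix a, hMatrix_mem a⟩

/-- Born rule: `|⟨v| U |p⟩|²`, the probability of the outcome `v` when `U` is applied to the
quoin `|p⟩`, which is then measured in the computational basis. -/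
def bornProb (U : Matrix.unitaryGroup (Fin 2) ℂ) (p : unitInterval) (v : Fin 2) : ℝ :=
  ‖((U : Matrix (Fin 2) (Fin 2) ℂ).mulVec (quoin p)) v‖ ^ 2

theorem bornProb_nonneg (U : Matrix.unitaryGroup (Fin 2) ℂ) (p : unitInterval) (v : Fin 2) :
    0 ≤ bornProb U p v := by
  unfold bornProb; positivity

theorem sum_bornProb (U : Matrix.unitaryGroup (Fin 2) ℂ) (p : unitInterval) :
    ∑ v, bornProb U p v = 1 := by
  have key : ∀ w : Fin 2 → ℂ, ((∑ v, ‖w v‖ ^ 2 : ℝ) : ℂ) = dotProduct (star w) w := by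
    intro w
    simp [dotProduct, Complex.conj_mul']
  have hU : (U : Matrix (Fin 2) (Fin 2) ℂ).conjTranspose * (U : Matrix (Fin 2) (Fin 2) ℂ) = 1 :=
    Matrix.mem_unitaryGroup_iff'.1 U.2
  have hq : ∑ v, ‖quoin p v‖ ^ 2 = 1 := by
    have h0 : (0 : ℝ) ≤ (p : ℝ) := p.2.1
    have h1 : (0 : ℝ) ≤ 1 - (p : ℝ) := sub_nonneg.2 p.2.2
    simp [quoin, Fin.sum_univ_two, Real.sq_sqrt h0, Real.sq_sqrt h1]
  have h : ((∑ v, bornProb U p v : ℝ) : ℂ) = ((∑ v, ‖quoin p v‖ ^ 2 : ℝ) : ℂ) := by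
    unfold bornProb
    rw [key, key, Matrix.star_mulVec, ← Matrix.dotProduct_mulVec, Matrix.mulVec_mulVec, hU,
      Matrix.one_mulVec]
  rw [hq] at h
  exact_mod_cast h

/-- The law of one measurement outcome. -/
def outcomeLaw (U : Matrix.unitaryGroup (Fin 2) ℂ) (p : unitInterval) : PMF (Fin 2) :=
  PMF.ofFintype (fun v => ENNReal.ofReal (bornProb U p v)) (by
    rw [← ENNReal.ofReal_sum_of_nonneg fun v _ => bornProb_nonneg U p v, sum_bornProb,
      ENNReal.ofReal_one])

/-- The sample space of `n` infinite sequences of binary outcomes: `X (i, j)` is the outcome of the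
measurement of the `j`-th quoin of the `i`-th stream. It carries the product topology, whose basic
open sets are the products of cylinder sets, and the product σ-algebra. -/
abbrev Sample (n : ℕ) : Type := Fin n × ℕ → Fin 2

/-- The probability measure `P_{p,G}`: all outcomes are independent, and every quoin of the `i`-th
stream has undergone the unitary `U i` before it is measured. -/
def quoinMeasure {n : ℕ} (U : Fin n → Matrix.unitaryGroup (Fin 2) ℂ) (p : unitInterval) :
    Measure (Sample n) :=
  Measure.infinitePi fun ij : Fin n × ℕ => (outcomeLaw (U ij.1) p).toMeasure

/-- A set `S` of outcome sequences is discernible if, almost surely, finitely many outcomes suffice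
to decide whether `S` occurs. A sequence `X ∈ S` is recognised after finitely many outcomes exactly
if some basic open neighbourhood of `X` lies in `S`, that is, if `X ∈ interior S`; and likewise for
the complement. -/
def Discernible {n : ℕ} (P : Measure (Sample n)) (S : Set (Sample n)) : Prop :=
  P (interior S) + P (interior Sᶜ) = 1

/-- `f` is constructible from quoins with finitely many single-qubit unitaries taken from `𝒰`: for
suitable `U 1, …, U n ∈ 𝒰` and an event `S` (all independent of `p`), the event `S` is
discernible and has probability `f p`, for every `p`. -/
def QConstructible (𝒰 : Set (Matrix.unitaryGroup (Fin 2) ℂ)) (f : unitInterval → unitInterval) :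
    Prop :=
  ∃ (n : ℕ) (U : Fin n → Matrix.unitaryGroup (Fin 2) ℂ) (S : Set (Sample n)),
    (∀ i, U i ∈ 𝒰) ∧
    ∀ p : unitInterval,
      NullMeasurableSet S (quoinMeasure U p) ∧
      Discernible (quoinMeasure U p) S ∧
      (quoinMeasure U p).real S = (f p : ℝ)

/-- Simple and poly-bounded functions. -/
structure IsSPB (f : unitInterval → unitInterval) : Prop where
  continuous : Continuous f
  finite_zeros : {z | f z = 0}.Finite
  finite_ones : {w | f w = 1}.Finite
  zero_bound : ∀ z, f z = 0 → ∃ c > (0 : ℝ), ∃ δ > (0 : ℝ), ∃ k : ℕ, ∀ p : unitInterval,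
    (p : ℝ) ∈ Set.Icc ((z : ℝ) - δ) ((z : ℝ) + δ) →
      c * ((p : ℝ) - (z : ℝ)) ^ (2 * k) ≤ (f p : ℝ)
  one_bound : ∀ w, f w = 1 → ∃ c > (0 : ℝ), ∃ δ > (0 : ℝ), ∃ k : ℕ, ∀ p : unitInterval,
    (p : ℝ) ∈ Set.Icc ((w : ℝ) - δ) ((w : ℝ) + δ) →
      (f p : ℝ) ≤ 1 - c * ((p : ℝ) - (w : ℝ)) ^ (2 * k)

end QuantumBernoulli

end

/-!
An event `S` that is discernible for every `p` has `f p = P_p(int S)` and `1 - f p = P_p(int Sᶜ)`.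
The probability of an open event is a supremum of probabilities of finite unions of cylinders, which
are continuous in `p`; so `f` and `1 - f` are lower semicontinuous, and `f` is continuous. If `f` is
not identically `0`, then `int S` contains a cylinder, whose probability is a product of finitely
many outcome probabilities `|⟨v|U|p⟩|²`. Such an outcome probability has at most one zero `z`, and
then it is at least `(p - z)²` (`sub_sq_le_bornProb`). This gives the finiteness of the zero set and
the polynomial lower bound, and the same argument for `1 - f` gives the rest
(`isSPB_or_trivial_of_qConstructible`).

Conversely, let `f` be simple and poly-bounded. The second outcome after the gate `H(1-z)` has a
probability that is at most `|p - z|` and vanishes only at `z`. Hence suitable products `q` and `r`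
of such probabilities have the zeros of `f` and of `1 - f`, and `c q ≤ f`, `c r ≤ 1 - f` for some
`c > 0` (`exists_mul_prod_zeroCoin_le`). The factory works on successive independent blocks of the
sample. On each block two disjoint clopen events `A` and `B` announce the outcomes `1` and `0`, such
that `a = P(A) ≤ f - c' q` and `b = P(B) ≤ 1 - f - c' r`, while `a + b` is bounded below by an
absolute constant. If nothing is announced, the process goes on with `(f - a) / (1 - a - b)`, which
satisfies the same hypotheses with `c'` in place of `c`, so that the step can be repeated
(`Admissible.exists_step`, `Admissible.exists_isOpen`).

The events are `A = D ∩ T ∩ Q` and `B = Dᶜ ∩ T ∩ R`, up to independent copies. Here `D` says that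
`f > 1/2` at the empirical frequency of a stream measured without rotation, which by the weak law of
large numbers almost decides whether `f p` is large or small; `Q` and `R` say that one of many
independent copies of events of probability `q` and `r` occurs, which keeps `a` and `b` below a
multiple of `q` and `r` but makes them large where `f` is not close to `0` and `1`, respectively;
and `T` has a probability in `[3/16, 1/4]` for all `p`. Such a `T` exists because the streams
measured after `H(0)` and after `H(1/2)` are never both deterministic (`bornProb_hGate_half`).
-/

noncomputable section

namespace QuantumBernoulli

open ProbabilityTheory Topology Filter

variable {n : ℕ} (U : Fin n → Matrix.unitaryGroup (Fin 2) ℂ)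

/-! ### Samples, cylinders and independent blocks -/

instance isProbabilityMeasure_quoinMeasure (p : unitInterval) :
    IsProbabilityMeasure (quoinMeasure U p) := by
  unfold quoinMeasure; infer_instance

theorem outcomeLaw_toMeasure_singleton (V : Matrix.unitaryGroup (Fin 2) ℂ) (p : unitInterval)
    (v : Fin 2) : (outcomeLaw V p).toMeasure {v} = ENNReal.ofReal (bornProb V p v) := by
  rw [PMF.toMeasure_apply_singleton _ _ (measurableSet_singleton v)]
  rfl

/-- The probability of the cylinder on which the outcomes indexed by `s` agree with `x`. -/
theorem quoinMeasure_cylinder (p : unitInterval) (s : Finset (Fin n × ℕ)) (x : Sample n) :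
    (quoinMeasure U p).real {y | ∀ ij ∈ s, y ij = x ij} =
      ∏ ij ∈ s, bornProb (U ij.1) p (x ij) := by
  have h : {y : Sample n | ∀ ij ∈ s, y ij = x ij} =
      Set.pi (s : Set (Fin n × ℕ)) fun ij => {x ij} := by
    ext y; simp [Set.mem_pi]
  rw [h, Measure.real, quoinMeasure, Measure.infinitePi_pi _ fun _ _ => measurableSet_singleton _]
  simp only [outcomeLaw_toMeasure_singleton, ENNReal.toReal_prod]
  exact Finset.prod_congr rfl fun ij _ => ENNReal.toReal_ofReal (bornProb_nonneg _ _ _)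

theorem isClopen_outcome (ij : Fin n × ℕ) (v : Fin 2) : IsClopen {X : Sample n | X ij = v} :=
  (isClopen_discrete {v}).preimage (continuous_apply ij)

theorem quoinMeasure_outcome (p : unitInterval) (ij : Fin n × ℕ) (v : Fin 2) :
    (quoinMeasure U p).real {X | X ij = v} = bornProb (U ij.1) p v := by
  simpa using quoinMeasure_cylinder U p {ij} fun _ => v

theorem isClopen_measurableSet {A : Set (Sample n)} (hA : IsClopen A) : MeasurableSet A :=
  hA.isOpen.measurableSet

/-- The `k`-th block of a sample. The blocks split each of the `n` streams into infinitely many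
disjoint streams, so that they are independent copies of the whole sample. -/
def block (k : ℕ) (X : Sample n) : Sample n := fun ij => X (ij.1, Nat.pair k ij.2)

theorem continuous_block (k : ℕ) : Continuous (block k : Sample n → Sample n) := by
  unfold block; fun_prop

theorem map_block (p : unitInterval) :
    (quoinMeasure U p).map (fun X k => block k X) =
      Measure.infinitePi fun _ : ℕ => quoinMeasure U p := by
  have hinj : Function.Injective fun q : ℕ × (Fin n × ℕ) => (q.2.1, Nat.pair q.1 q.2.2) := by
    rintro ⟨k, i, j⟩ ⟨k', i', j'⟩ h
    simp only [Prod.mk.injEq, Nat.pair_eq_pair] at h ⊢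
    exact ⟨h.2.1, h.1, h.2.2⟩
  have h1 := Measure.map_infinitePi_infinitePi_of_inj
    (P := fun ij : Fin n × ℕ => (outcomeLaw (U ij.1) p).toMeasure) hinj
  have h2 := Measure.infinitePi_map_curry
    fun (_ : ℕ) (ij : Fin n × ℕ) => (outcomeLaw (U ij.1) p).toMeasure
  rw [← h1, Measure.map_map (by fun_prop) (by fun_prop)] at h2
  exact h2

/-- Events about different blocks are independent. -/
theorem quoinMeasure_forall_block (p : unitInterval) {D : ℕ → Set (Sample n)}
    (hD : ∀ k, IsClopen (D k)) (K : ℕ) :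
    (quoinMeasure U p).real {X | ∀ k < K, block k X ∈ D k} =
      ∏ k ∈ Finset.range K, (quoinMeasure U p).real (D k) := by
  have hm : ∀ k ∈ Finset.range K, MeasurableSet (D k) := fun k _ => isClopen_measurableSet (hD k)
  have hmeas : Measurable fun (X : Sample n) k => block k X :=
    measurable_pi_iff.2 fun k => (continuous_block k).measurable
  have h := Measure.infinitePi_pi (fun _ : ℕ => quoinMeasure U p) hm
  rw [← map_block, Measure.map_apply hmeas (MeasurableSet.pi (Finset.countable_toSet _) hm)] at h
  have hset : {X : Sample n | ∀ k < K, block k X ∈ D k} =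
      (fun (X : Sample n) k => block k X) ⁻¹' (Set.pi (Finset.range K : Set ℕ) D) := by
    ext X; simp [Set.mem_pi]
  rw [hset, Measure.real, h, ENNReal.toReal_prod]
  rfl

theorem isClopen_block_preimage {A : Set (Sample n)} (hA : IsClopen A) (k : ℕ) :
    IsClopen {X | block k X ∈ A} :=
  hA.preimage (continuous_block k)

theorem quoinMeasure_block_inter (p : unitInterval) {A B : Set (Sample n)}
    (hA : IsClopen A) (hB : IsClopen B) :
    (quoinMeasure U p).real ({X | block 0 X ∈ A} ∩ {X | block 1 X ∈ B}) =
      (quoinMeasure U p).real A * (quoinMeasure U p).real B := by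
  have h := quoinMeasure_forall_block U p (D := fun k => if k = 0 then A else B)
    (fun k => by split_ifs <;> assumption) 2
  rw [Finset.prod_range_succ, Finset.prod_range_one] at h
  simp only [if_true, one_ne_zero, if_false] at h
  rw [← h]
  congr 1
  ext X
  constructor
  · rintro ⟨h0, h1⟩ k hk
    interval_cases k <;> simpa
  · intro hX
    exact ⟨by simpa using hX 0 (by norm_num), by simpa using hX 1 (by norm_num)⟩

theorem quoinMeasure_compl (p : unitInterval) {A : Set (Sample n)} (hA : IsClopen A) :
    (quoinMeasure U p).real Aᶜ = 1 - (quoinMeasure U p).real A :=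
  probReal_compl_eq_one_sub (isClopen_measurableSet hA)

/-- `g p` is the probability of a clopen event, that is, of an event decided by a bounded number of
outcomes. -/
def IsClopenProb (g : unitInterval → ℝ) : Prop :=
  ∃ A : Set (Sample n), IsClopen A ∧ ∀ p, (quoinMeasure U p).real A = g p

namespace IsClopenProb

variable {U} {g h : unitInterval → ℝ}

theorem nonneg (hg : IsClopenProb U g) (p : unitInterval) : 0 ≤ g p := by
  obtain ⟨A, -, hA⟩ := hg
  rw [← hA]; exact measureReal_nonneg

theorem le_one (hg : IsClopenProb U g) (p : unitInterval) : g p ≤ 1 := by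
  obtain ⟨A, -, hA⟩ := hg
  rw [← hA]; exact measureReal_le_one

theorem one : IsClopenProb U fun _ => 1 := ⟨Set.univ, isClopen_univ, fun p => by simp⟩

theorem compl (hg : IsClopenProb U g) : IsClopenProb U fun p => 1 - g p := by
  obtain ⟨A, hA, h⟩ := hg
  exact ⟨Aᶜ, hA.compl, fun p => by rw [quoinMeasure_compl U p hA, h]⟩

theorem mul (hg : IsClopenProb U g) (hh : IsClopenProb U h) :
    IsClopenProb U fun p => g p * h p := by
  obtain ⟨A, hA, h1⟩ := hg
  obtain ⟨B, hB, h2⟩ := hh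
  exact ⟨_, (isClopen_block_preimage hA 0).inter (isClopen_block_preimage hB 1),
    fun p => by rw [quoinMeasure_block_inter U p hA hB, h1, h2]⟩

theorem pow (hg : IsClopenProb U g) (m : ℕ) : IsClopenProb U fun p => g p ^ m := by
  induction m with
  | zero => simpa using one
  | succ m ih => simpa only [pow_succ] using ih.mul hg

theorem prod {ι : Type*} (s : Finset ι) {G : ι → unitInterval → ℝ}
    (hG : ∀ i ∈ s, IsClopenProb U (G i)) : IsClopenProb U fun p => ∏ i ∈ s, G i p := by
  classical
  induction s using Finset.induction_on with
  | empty => simpa using one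
  | insert a s ha ih =>
    simp only [Finset.prod_insert ha]
    exact (hG a (Finset.mem_insert_self a s)).mul
      (ih fun i hi => hG i (Finset.mem_insert_of_mem hi))

end IsClopenProb

theorem isClopenProb_bornProb (i : Fin n) (v : Fin 2) :
    IsClopenProb U fun p => bornProb (U i) p v :=
  ⟨_, isClopen_outcome (i, 0) v, fun p => quoinMeasure_outcome U p (i, 0) v⟩

/-! ### Outcome probabilities of single-qubit gates -/

theorem continuous_bornProb (V : Matrix.unitaryGroup (Fin 2) ℂ) (v : Fin 2) :
    Continuous fun p => bornProb V p v := by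
  simp only [bornProb, Matrix.mulVec, dotProduct, Fin.sum_univ_two, quoin, Matrix.cons_val_zero,
    Matrix.cons_val_one]
  fun_prop

theorem bornProb_one (V : Matrix.unitaryGroup (Fin 2) ℂ) (p : unitInterval) :
    bornProb V p 1 = 1 - bornProb V p 0 := by
  have h := sum_bornProb V p
  rw [Fin.sum_univ_two] at h
  linarith

theorem normSq_row_unitary (V : Matrix.unitaryGroup (Fin 2) ℂ) (v : Fin 2) :
    ‖(V : Matrix (Fin 2) (Fin 2) ℂ) v 0‖ ^ 2 + ‖(V : Matrix (Fin 2) (Fin 2) ℂ) v 1‖ ^ 2 = 1 := by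
  have h := congrFun (congrFun (Matrix.mem_unitaryGroup_iff.1 V.2) v) v
  simp only [Matrix.mul_apply, Fin.sum_univ_two, Matrix.star_apply, Matrix.one_apply_eq,
    RCLike.star_def, Complex.mul_conj'] at h
  exact_mod_cast h

/-- For `p = sin² α` and `z = sin² β` with `α, β ∈ [0, π/2]`, the right-hand side is
`sin² (α - β)`, while `p - z = sin (α - β) sin (α + β)`. -/
theorem sub_sq_le_sq_sub (p z : unitInterval) :
    ((p : ℝ) - z) ^ 2 ≤ (√(1 - (z : ℝ)) * √(p : ℝ) - √(z : ℝ) * √(1 - (p : ℝ))) ^ 2 := by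
  have hx := Real.sq_sqrt p.2.1
  have hy := Real.sq_sqrt (sub_nonneg.2 p.2.2)
  have hs := Real.sq_sqrt z.2.1
  have ht := Real.sq_sqrt (sub_nonneg.2 z.2.2)
  set x := √(p : ℝ)
  set y := √(1 - (p : ℝ))
  set s := √(z : ℝ)
  set t := √(1 - (z : ℝ))
  have h1 : (p : ℝ) - z = (t * x - s * y) * (t * x + s * y) := by
    linear_combination (-t ^ 2) * hx + s ^ 2 * hy - (p : ℝ) * ht + (1 - (p : ℝ)) * hs
  have h2 : (t * x + s * y) ^ 2 + (t * y - s * x) ^ 2 = 1 := by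
    linear_combination (t ^ 2 + s ^ 2) * (hx + hy) + ht + hs
  rw [h1, mul_pow]
  exact mul_le_of_le_one_right (sq_nonneg _) (by nlinarith [sq_nonneg (t * y - s * x)])

/-- An outcome probability has at most one zero, of order at most two: the amplitude at `p` is,
up to a phase, the component of the unit vector `(√p, √(1-p))` orthogonal to `(√z, √(1-z))`. -/
theorem sub_sq_le_bornProb (V : Matrix.unitaryGroup (Fin 2) ℂ) {v : Fin 2} {z : unitInterval}
    (hz : bornProb V z v = 0) (p : unitInterval) : ((p : ℝ) - z) ^ 2 ≤ bornProb V p v := by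
  refine (sub_sq_le_sq_sub p z).trans_eq ?_
  have hrow := normSq_row_unitary V v
  simp only [bornProb, Matrix.mulVec, dotProduct, Fin.sum_univ_two, quoin, Matrix.cons_val_zero,
    Matrix.cons_val_one, sq_eq_zero_iff, norm_eq_zero] at hz ⊢
  have hs := Real.sq_sqrt z.2.1
  have ht := Real.sq_sqrt (sub_nonneg.2 z.2.2)
  set a := (V : Matrix (Fin 2) (Fin 2) ℂ) v 0
  set b := (V : Matrix (Fin 2) (Fin 2) ℂ) v 1
  set x := √(p : ℝ)
  set y := √(1 - (p : ℝ))
  set s := √(z : ℝ)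
  set t := √(1 - (z : ℝ))
  have hst : (s : ℂ) ^ 2 + (t : ℂ) ^ 2 = 1 := by
    have : s ^ 2 + t ^ 2 = 1 := by linarith
    exact_mod_cast this
  have ha : a = t * (a * t - b * s) := by linear_combination (-a) * hst + s * hz
  have hb : b = -s * (a * t - b * s) := by linear_combination (-b) * hst + t * hz
  have hna : ‖a‖ ^ 2 = t ^ 2 * ‖a * t - b * s‖ ^ 2 := by
    conv_lhs => rw [ha]
    rw [norm_mul, mul_pow, Complex.norm_real, Real.norm_eq_abs, sq_abs]
  have hnb : ‖b‖ ^ 2 = s ^ 2 * ‖a * t - b * s‖ ^ 2 := by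
    conv_lhs => rw [hb]
    rw [norm_mul, mul_pow, norm_neg, Complex.norm_real, Real.norm_eq_abs, sq_abs]
  have hl : ‖a * t - b * s‖ ^ 2 = 1 := by
    rw [hna, hnb, hs, ht] at hrow
    linarith
  have hab : a * x + b * y = ((t * x - s * y : ℝ) : ℂ) * (a * t - b * s) := by
    push_cast
    linear_combination (x : ℂ) * ha + (y : ℂ) * hb
  rw [hab, norm_mul, mul_pow, hl, mul_one, Complex.norm_real, Real.norm_eq_abs, sq_abs]

theorem bornProb_hGate_zero (a p : unitInterval) :
    bornProb (hGate a) p 0 =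
      (√(1 - (a : ℝ)) * √(p : ℝ) + √(a : ℝ) * √(1 - (p : ℝ))) ^ 2 := by
  simp only [bornProb, Matrix.mulVec, dotProduct, Fin.sum_univ_two, quoin, hGate, hMatrix,
    Matrix.cons_val_zero, Matrix.cons_val_one, Matrix.of_apply, Matrix.cons_val',
    ← Complex.ofReal_mul, ← Complex.ofReal_add, Complex.norm_real, Real.norm_eq_abs, sq_abs]

theorem bornProb_hGate_one (a p : unitInterval) :
    bornProb (hGate a) p 1 =
      (√(a : ℝ) * √(p : ℝ) - √(1 - (a : ℝ)) * √(1 - (p : ℝ))) ^ 2 := by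
  simp only [bornProb, Matrix.mulVec, dotProduct, Fin.sum_univ_two, quoin, hGate, hMatrix,
    Matrix.cons_val_zero, Matrix.cons_val_one, Matrix.of_apply, Matrix.cons_val',
    ← Complex.ofReal_neg, ← Complex.ofReal_mul, ← Complex.ofReal_add,
    Complex.norm_real, Real.norm_eq_abs, sq_abs, neg_mul, sub_eq_add_neg]

theorem bornProb_hGate_zero_zero (p : unitInterval) : bornProb (hGate 0) p 0 = p := by
  rw [bornProb_hGate_zero]
  simp [Real.sq_sqrt p.2.1]

/-- The outcome probabilities of the gates `H(0)` and `H(1/2)` complement each other: at no `p` are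
both measurements deterministic. -/
theorem bornProb_hGate_half (p : unitInterval) {a : unitInterval} (ha : (a : ℝ) = 1 / 2) :
    bornProb (hGate a) p 0 * (1 - bornProb (hGate a) p 0) = 1 / 4 - p * (1 - (p : ℝ)) := by
  have e : (1 : ℝ) - 1 / 2 = 1 / 2 := by norm_num
  rw [bornProb_hGate_zero, ha, e]
  have hx := Real.sq_sqrt p.2.1
  have hy := Real.sq_sqrt (sub_nonneg.2 p.2.2)
  have hh := Real.sq_sqrt (show (0 : ℝ) ≤ 1 / 2 by norm_num)
  set x := √(p : ℝ)
  set y := √(1 - (p : ℝ))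
  have h1 : (√(1 / 2) * x + √(1 / 2) * y) ^ 2 = 1 / 2 + x * y := by
    linear_combination (x + y) ^ 2 * hh + 1 / 2 * hx + 1 / 2 * hy
  rw [h1, ← hx, show (1 : ℝ) - x ^ 2 = y ^ 2 by rw [hx, hy]]
  ring

/-- The probability, as a function of `p`, of the second outcome after the gate `H(1-z)`. It
vanishes exactly at `z`. -/
def zeroCoin (z p : unitInterval) : ℝ := bornProb (hGate (unitInterval.symm z)) p 1

theorem zeroCoin_eq (z p : unitInterval) :
    zeroCoin z p = (√(1 - (z : ℝ)) * √(p : ℝ) - √(z : ℝ) * √(1 - (p : ℝ))) ^ 2 := by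
  rw [zeroCoin, bornProb_hGate_one]
  simp

theorem zeroCoin_le (z p : unitInterval) : zeroCoin z p ≤ |(p : ℝ) - z| := by
  rw [zeroCoin_eq]
  have hx := Real.sq_sqrt p.2.1
  have hy := Real.sq_sqrt (sub_nonneg.2 p.2.2)
  have hs := Real.sq_sqrt z.2.1
  have ht := Real.sq_sqrt (sub_nonneg.2 z.2.2)
  have hx0 := Real.sqrt_nonneg (p : ℝ)
  have hy0 := Real.sqrt_nonneg (1 - (p : ℝ))
  have hs0 := Real.sqrt_nonneg (z : ℝ)
  have ht0 := Real.sqrt_nonneg (1 - (z : ℝ))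
  set x := √(p : ℝ)
  set y := √(1 - (p : ℝ))
  set s := √(z : ℝ)
  set t := √(1 - (z : ℝ))
  have h1 : (p : ℝ) - z = (t * x - s * y) * (t * x + s * y) := by
    linear_combination (-t ^ 2) * hx + s ^ 2 * hy - (p : ℝ) * ht + (1 - (p : ℝ)) * hs
  have h2 : |t * x - s * y| ≤ t * x + s * y := by
    rw [abs_le]; constructor <;> nlinarith [mul_nonneg ht0 hx0, mul_nonneg hs0 hy0]
  rw [h1, abs_mul, abs_of_nonneg (a := t * x + s * y) (by positivity), ← sq_abs, sq]
  exact mul_le_mul_of_nonneg_left h2 (abs_nonneg _)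

theorem zeroCoin_nonneg (z p : unitInterval) : 0 ≤ zeroCoin z p := bornProb_nonneg _ _ _

theorem zeroCoin_le_one (z p : unitInterval) : zeroCoin z p ≤ 1 := by
  have h := bornProb_one (hGate (unitInterval.symm z)) p
  have h' := bornProb_nonneg (hGate (unitInterval.symm z)) p 0
  unfold zeroCoin
  linarith

theorem zeroCoin_pos {z p : unitInterval} (h : p ≠ z) : 0 < zeroCoin z p := by
  rw [zeroCoin_eq]
  refine lt_of_lt_of_le ?_ (sub_sq_le_sq_sub p z)
  have : (p : ℝ) - z ≠ 0 := sub_ne_zero.2 fun h' => h (Subtype.ext h')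
  positivity

/-- A product of coins, with the same zeros as the poly-bounded function `f`, which is dominated by
a multiple of `f`. -/
theorem exists_mul_prod_zeroCoin_le {f : unitInterval → ℝ} (hf : Continuous f) (h0 : ∀ p, 0 ≤ f p)
    (hZ : {z | f z = 0}.Finite)
    (hb : ∀ z, f z = 0 → ∃ c > (0 : ℝ), ∃ δ > (0 : ℝ), ∃ k : ℕ, ∀ p : unitInterval,
      (p : ℝ) ∈ Set.Icc ((z : ℝ) - δ) ((z : ℝ) + δ) →
        c * ((p : ℝ) - (z : ℝ)) ^ (2 * k) ≤ f p) :
    ∃ k : unitInterval → ℕ, ∃ c > (0 : ℝ),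
      ∀ p, c * ∏ z ∈ hZ.toFinset, zeroCoin z p ^ (2 * k z) ≤ f p := by
  choose! c hc δ hδ k hk using hb
  refine ⟨k, ?_⟩
  have hq0 : ∀ p, 0 ≤ ∏ z ∈ hZ.toFinset, zeroCoin z p ^ (2 * k z) := fun p =>
    Finset.prod_nonneg fun z _ => pow_nonneg (zeroCoin_nonneg z p) _
  have hq1 : ∀ p, ∏ z ∈ hZ.toFinset, zeroCoin z p ^ (2 * k z) ≤ 1 := fun p =>
    Finset.prod_le_one (fun z _ => pow_nonneg (zeroCoin_nonneg z p) _)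
      fun z _ => pow_le_one₀ (zeroCoin_nonneg z p) (zeroCoin_le_one z p)
  have key : ∃ c > (0 : ℝ), ∀ p ∈ (Set.univ : Set unitInterval),
      c * ∏ z ∈ hZ.toFinset, zeroCoin z p ^ (2 * k z) ≤ f p := by
    refine isCompact_univ.induction_on
      (p := fun s : Set unitInterval => ∃ c > (0 : ℝ), ∀ p ∈ s,
        c * ∏ z ∈ hZ.toFinset, zeroCoin z p ^ (2 * k z) ≤ f p)
      ⟨1, one_pos, by simp⟩ ?_ ?_ ?_
    · rintro s t hst ⟨c, hc, h⟩
      exact ⟨c, hc, fun p hp => h p (hst hp)⟩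
    · rintro s t ⟨c, hc, h⟩ ⟨c', hc', h'⟩
      refine ⟨min c c', lt_min hc hc', ?_⟩
      rintro p (hp | hp)
      · exact (mul_le_mul_of_nonneg_right (min_le_left _ _) (hq0 p)).trans (h p hp)
      · exact (mul_le_mul_of_nonneg_right (min_le_right _ _) (hq0 p)).trans (h' p hp)
    · intro x _
      rw [nhdsWithin_univ]
      by_cases hx : f x = 0
      · have hnhds : {p : unitInterval | (p : ℝ) ∈ Set.Icc ((x : ℝ) - δ x) ((x : ℝ) + δ x)} ∈ 𝓝 x :=
          continuous_subtype_val.continuousAt.preimage_mem_nhds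
            (Icc_mem_nhds (by linarith [hδ x hx]) (by linarith [hδ x hx]))
        refine ⟨_, hnhds, c x, hc x hx, fun p hp => le_trans ?_ (hk x hx p hp)⟩
        refine mul_le_mul_of_nonneg_left ?_ (hc x hx).le
        have hxmem : x ∈ hZ.toFinset := by simpa using hx
        rw [← Finset.mul_prod_erase _ _ hxmem]
        refine (mul_le_of_le_one_right (pow_nonneg (zeroCoin_nonneg x p) _)
          (Finset.prod_le_one (fun z _ => pow_nonneg (zeroCoin_nonneg z p) _)
            fun z _ => pow_le_one₀ (zeroCoin_nonneg z p) (zeroCoin_le_one z p))).trans ?_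
        refine (pow_le_pow_left₀ (zeroCoin_nonneg x p) (zeroCoin_le x p) _).trans_eq ?_
        rw [pow_mul, sq_abs, ← pow_mul]
      · have hpos : 0 < f x := lt_of_le_of_ne (h0 x) (Ne.symm hx)
        refine ⟨{p | f x / 2 < f p}, (isOpen_lt continuous_const hf).mem_nhds
          (half_lt_self hpos), f x / 2, by linarith, fun p hp => ?_⟩
        exact (mul_le_of_le_one_right (by linarith) (hq1 p)).trans (le_of_lt hp)
  obtain ⟨c, hc, h⟩ := key
  exact ⟨c, hc, fun p => h p (Set.mem_univ p)⟩

/-! ### Open events: constructible functions are simple and poly-bounded -/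

/-- The union of the cylinders over the coordinates in `s` that are contained in `O`. -/
def cylinderInterior (s : Finset (Fin n × ℕ)) (O : Set (Sample n)) : Set (Sample n) :=
  {x | ∀ y : Sample n, (∀ ij ∈ s, y ij = x ij) → y ∈ O}

theorem cylinderInterior_subset (s : Finset (Fin n × ℕ)) (O : Set (Sample n)) :
    cylinderInterior s O ⊆ O := fun x hx => hx x fun _ _ => rfl

theorem cylinderInterior_mono {s t : Finset (Fin n × ℕ)} (h : s ⊆ t) (O : Set (Sample n)) :
    cylinderInterior s O ⊆ cylinderInterior t O :=
  fun _ hx y hy => hx y fun ij hij => hy ij (h hij)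

theorem exists_mem_cylinderInterior {O : Set (Sample n)} (hO : IsOpen O) {x : Sample n}
    (hx : x ∈ O) : ∃ s, x ∈ cylinderInterior s O := by
  obtain ⟨s, u, hu, hsu⟩ := isOpen_pi_iff.1 hO x hx
  exact ⟨s, fun y hy => hsu fun ij hij => by rw [hy ij hij]; exact (hu ij hij).2⟩

theorem continuous_quoinMeasure_cylinderInterior (s : Finset (Fin n × ℕ)) (O : Set (Sample n)) :
    Continuous fun p => quoinMeasure U p (cylinderInterior s O) := by
  classical
  have hset : cylinderInterior s O =
      s.restrict ⁻¹' (s.restrict '' cylinderInterior s O : Set (s → Fin 2)) := by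
    refine Set.Subset.antisymm (Set.subset_preimage_image _ _) ?_
    rintro x ⟨x', hx', hxx'⟩ y hy
    refine hx' y fun ij hij => ?_
    rw [hy ij hij]
    exact (congrFun hxx' ⟨ij, hij⟩).symm
  have h : ∀ p, quoinMeasure U p (cylinderInterior s O) =
      ∑ y : s → Fin 2 with y ∈ (s.restrict '' cylinderInterior s O : Set (s → Fin 2)),
        ∏ ij : s, ENNReal.ofReal (bornProb (U ij.1.1) p (y ij)) := by
    intro p
    rw [hset, ← Measure.map_apply (Finset.measurable_restrict _) (Set.toFinite _).measurableSet,
      quoinMeasure, Measure.infinitePi_map_restrict, ← hset]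
    rw [← Finset.sum_congr rfl fun y _ => Finset.prod_congr rfl fun ij _ =>
      outcomeLaw_toMeasure_singleton (U ij.1.1) p (y ij)]
    simp_rw [← Measure.pi_singleton]
    rw [sum_measure_singleton]
    congr 1
    ext y; simp
  simp_rw [h]
  exact continuous_finsetSum _ fun y _ => by
    simp_rw [← ENNReal.ofReal_prod_of_nonneg fun _ _ => bornProb_nonneg _ _ _]
    exact ENNReal.continuous_ofReal.comp
      (continuous_finsetProd _ fun ij _ => continuous_bornProb _ _)

/-- The probability of an open event is the supremum of the probabilities that the event has been
decided by the first `N` outcomes of each stream, and these depend continuously on `p`. -/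
theorem lowerSemicontinuous_quoinMeasure {O : Set (Sample n)} (hO : IsOpen O) :
    LowerSemicontinuous fun p => quoinMeasure U p O := by
  set s : ℕ → Finset (Fin n × ℕ) := fun N => Finset.univ ×ˢ Finset.range N
  have hs : Monotone s := fun a b hab =>
    Finset.product_subset_product_right (Finset.range_subset_range.2 hab)
  have hmono : Monotone fun N => cylinderInterior (s N) O :=
    fun a b hab => cylinderInterior_mono (hs hab) O
  have hU : O = ⋃ N, cylinderInterior (s N) O := by
    refine Set.Subset.antisymm (fun x hx => ?_)
      (Set.iUnion_subset fun N => cylinderInterior_subset _ _)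
    obtain ⟨t, ht⟩ := exists_mem_cylinderInterior hO hx
    refine Set.mem_iUnion.2 ⟨t.sup fun ij => ij.2 + 1, cylinderInterior_mono (fun ij hij => ?_) O ht⟩
    simp only [s, Finset.mem_product, Finset.mem_univ, Finset.mem_range, true_and]
    exact Nat.lt_of_succ_le (Finset.le_sup (f := fun ij : Fin n × ℕ => ij.2 + 1) hij)
  have h : ∀ p, quoinMeasure U p O = ⨆ N, quoinMeasure U p (cylinderInterior (s N) O) := by
    intro p
    conv_lhs => rw [hU]
    exact hmono.measure_iUnion
  simp_rw [h]
  exact lowerSemicontinuous_iSup fun N =>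
    (continuous_quoinMeasure_cylinderInterior U (s N) O).lowerSemicontinuous

theorem lowerSemicontinuous_quoinMeasure_real {O : Set (Sample n)} (hO : IsOpen O) :
    LowerSemicontinuous fun p => (quoinMeasure U p).real O := by
  intro p c hc
  rcases lt_or_ge c 0 with hneg | hnn
  · exact Eventually.of_forall fun _ => hneg.trans_le measureReal_nonneg
  have h := lowerSemicontinuous_quoinMeasure U hO p (ENNReal.ofReal c)
    ((ENNReal.ofReal_lt_iff_lt_toReal hnn (measure_ne_top _ _)).2 hc)
  filter_upwards [h] with p' hp'
  exact (ENNReal.ofReal_lt_iff_lt_toReal hnn (measure_ne_top _ _)).1 hp'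

theorem exists_prod_bornProb_le {O : Set (Sample n)} (hO : IsOpen O) (hne : O.Nonempty) :
    ∃ (s : Finset (Fin n × ℕ)) (x : Sample n),
      ∀ p, ∏ ij ∈ s, bornProb (U ij.1) p (x ij) ≤ (quoinMeasure U p).real O := by
  obtain ⟨x, hx⟩ := hne
  obtain ⟨s, hs⟩ := exists_mem_cylinderInterior hO hx
  exact ⟨s, x, fun p => by
    rw [← quoinMeasure_cylinder]
    exact measureReal_mono fun y hy => hs y hy⟩

theorem finite_setOf_bornProb_eq_zero (V : Matrix.unitaryGroup (Fin 2) ℂ) (v : Fin 2) :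
    {z | bornProb V z v = 0}.Finite := by
  refine Set.Subsingleton.finite fun z hz p hp => Subtype.ext ?_
  have h := sub_sq_le_bornProb V hz p
  rw [show bornProb V p v = 0 from hp] at h
  have := pow_eq_zero_iff (two_ne_zero) |>.1 (le_antisymm h (sq_nonneg _))
  linarith

theorem exists_pow_le_bornProb (V : Matrix.unitaryGroup (Fin 2) ℂ) (v : Fin 2)
    (z : unitInterval) :
    ∃ c > (0 : ℝ), ∃ k : ℕ, ∀ᶠ p : unitInterval in 𝓝 z,
      c * ((p : ℝ) - z) ^ (2 * k) ≤ bornProb V p v := by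
  by_cases hz : bornProb V z v = 0
  · exact ⟨1, one_pos, 1, Eventually.of_forall fun p => by
      simpa using sub_sq_le_bornProb V hz p⟩
  · have hpos := lt_of_le_of_ne (bornProb_nonneg V z v) (Ne.symm hz)
    refine ⟨bornProb V z v / 2, half_pos hpos, 0, ?_⟩
    filter_upwards [(continuous_bornProb V v).continuousAt.eventually_const_lt (half_lt_self hpos)]
      with p hp
    simpa using hp.le

theorem exists_pow_le_prod_bornProb (s : Finset (Fin n × ℕ)) (x : Sample n) (z : unitInterval) :
    ∃ c > (0 : ℝ), ∃ k : ℕ, ∀ᶠ p : unitInterval in 𝓝 z,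
      c * ((p : ℝ) - z) ^ (2 * k) ≤ ∏ ij ∈ s, bornProb (U ij.1) p (x ij) := by
  classical
  induction s using Finset.induction_on with
  | empty => exact ⟨1, one_pos, 0, Eventually.of_forall fun p => by simp⟩
  | insert a s ha ih =>
    obtain ⟨c, hc, k, h⟩ := ih
    obtain ⟨c', hc', k', h'⟩ := exists_pow_le_bornProb (U a.1) (x a) z
    refine ⟨c' * c, mul_pos hc' hc, k' + k, ?_⟩
    filter_upwards [h, h'] with p hp hp'
    rw [Finset.prod_insert ha]
    calc c' * c * ((p : ℝ) - z) ^ (2 * (k' + k))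
        = (c' * ((p : ℝ) - z) ^ (2 * k')) * (c * ((p : ℝ) - z) ^ (2 * k)) := by ring
      _ ≤ _ := mul_le_mul hp' hp
        (mul_nonneg hc.le ((even_two_mul k).pow_nonneg _)) (bornProb_nonneg _ _ _)

theorem continuous_of_lowerSemicontinuous_one_sub {g : unitInterval → ℝ}
    (hl : LowerSemicontinuous g) (hu : LowerSemicontinuous fun p => 1 - g p) : Continuous g := by
  refine continuous_iff_lower_upperSemicontinuous.2 ⟨hl, fun p c hc => ?_⟩
  filter_upwards [hu p (1 - c) (by linarith)] with p' hp'
  linarith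

theorem IsClopenProb.continuous {U : Fin n → Matrix.unitaryGroup (Fin 2) ℂ}
    {g : unitInterval → ℝ} (hg : IsClopenProb U g) : Continuous g := by
  obtain ⟨A, hA, h⟩ := hg
  have hl := lowerSemicontinuous_quoinMeasure_real U hA.isOpen
  have hu := lowerSemicontinuous_quoinMeasure_real U hA.compl.isOpen
  simp only [quoinMeasure_compl U _ hA] at hu
  simp only [h] at hl hu
  exact continuous_of_lowerSemicontinuous_one_sub hl hu

/-- If the probability of an open event is not identically zero, the event contains a cylinder, and
the probability of this cylinder is a product of outcome probabilities. -/
theorem finite_zeros_and_bound_of_isOpen {O : Set (Sample n)} (hO : IsOpen O) (hne : O.Nonempty) :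
    {z | (quoinMeasure U z).real O = 0}.Finite ∧
    ∀ z : unitInterval, ∃ c > (0 : ℝ), ∃ δ > (0 : ℝ), ∃ k : ℕ, ∀ p : unitInterval,
      (p : ℝ) ∈ Set.Icc ((z : ℝ) - δ) ((z : ℝ) + δ) →
        c * ((p : ℝ) - z) ^ (2 * k) ≤ (quoinMeasure U p).real O := by
  obtain ⟨s, x, hs⟩ := exists_prod_bornProb_le U hO hne
  constructor
  · refine (s.finite_toSet.biUnion fun ij _ =>
      finite_setOf_bornProb_eq_zero (U ij.1) (x ij)).subset fun z hz => ?_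
    have h := hs z
    rw [show (quoinMeasure U z).real O = 0 from hz] at h
    have h0 := le_antisymm h (Finset.prod_nonneg fun ij _ => bornProb_nonneg _ _ _)
    obtain ⟨ij, hij, h1⟩ := Finset.prod_eq_zero_iff.1 h0
    exact Set.mem_biUnion hij h1
  · intro z
    obtain ⟨c, hc, k, h⟩ := exists_pow_le_prod_bornProb U s x z
    obtain ⟨ε, hε, h⟩ := Metric.eventually_nhds_iff.1 h
    refine ⟨c, hc, ε / 2, half_pos hε, k, fun p hp => (h ?_).trans (hs p)⟩
    rw [Subtype.dist_eq, Real.dist_eq, abs_lt]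
    constructor <;> linarith [hp.1, hp.2]

theorem isSPB_or_trivial_of_qConstructible {𝒰 : Set (Matrix.unitaryGroup (Fin 2) ℂ)}
    {f : unitInterval → unitInterval} (h : QConstructible 𝒰 f) :
    IsSPB f ∨ (∀ p, f p = 0) ∨ (∀ p, f p = 1) := by
  obtain ⟨n, U, S, -, h⟩ := h
  have key : ∀ p, (quoinMeasure U p).real (interior S) = f p ∧
      (quoinMeasure U p).real (interior Sᶜ) = 1 - f p := by
    intro p
    obtain ⟨hS, hd, hf⟩ := h p
    have h1 : (quoinMeasure U p).real (interior S) ≤ (quoinMeasure U p).real S :=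
      measureReal_mono interior_subset
    have h2 : (quoinMeasure U p).real (interior Sᶜ) ≤ (quoinMeasure U p).real Sᶜ :=
      measureReal_mono interior_subset
    have h3 : (quoinMeasure U p).real Sᶜ = 1 - (quoinMeasure U p).real S :=
      probReal_compl_eq_one_sub₀ hS
    have h4 : (quoinMeasure U p).real (interior S) + (quoinMeasure U p).real (interior Sᶜ) = 1 := by
      have := congrArg ENNReal.toReal hd
      rwa [ENNReal.toReal_add (measure_ne_top _ _) (measure_ne_top _ _), ENNReal.toReal_one] at this
    constructor <;> linarith
  by_cases h0 : ∀ p, f p = 0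
  · exact Or.inr (Or.inl h0)
  by_cases h1 : ∀ p, f p = 1
  · exact Or.inr (Or.inr h1)
  push Not at h0 h1
  left
  have hne : (interior S).Nonempty := by
    obtain ⟨p, hp⟩ := h0
    rw [Set.nonempty_iff_ne_empty]
    intro he
    have := (key p).1
    rw [he, measureReal_empty] at this
    exact hp (Subtype.ext this.symm)
  have hne' : (interior Sᶜ).Nonempty := by
    obtain ⟨p, hp⟩ := h1
    rw [Set.nonempty_iff_ne_empty]
    intro he
    have := (key p).2
    rw [he, measureReal_empty] at this
    exact hp (Subtype.ext (by simp only [Set.Icc.coe_one]; linarith))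
  obtain ⟨hZ, hzb⟩ := finite_zeros_and_bound_of_isOpen U isOpen_interior hne
  obtain ⟨hW, hwb⟩ := finite_zeros_and_bound_of_isOpen U isOpen_interior hne'
  have hl := lowerSemicontinuous_quoinMeasure_real U (O := interior S) isOpen_interior
  have hu := lowerSemicontinuous_quoinMeasure_real U (O := interior Sᶜ) isOpen_interior
  simp only [fun p => (key p).1] at hZ hzb hl
  simp only [fun p => (key p).2] at hW hwb hu
  refine ⟨?_, ?_, ?_, fun z _ => hzb z, fun w _ => ?_⟩
  · exact Continuous.subtype_mk (f := fun p => (f p : ℝ))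
      (continuous_of_lowerSemicontinuous_one_sub hl hu) _
  · exact hZ.subset fun z (hz : f z = 0) => by simp [hz]
  · exact hW.subset fun z (hz : f z = 1) => by simp [hz]
  · obtain ⟨c, hc, δ, hδ, k, hk⟩ := hwb w
    exact ⟨c, hc, δ, hδ, k, fun p hp => by linarith [hk p hp]⟩

/-! ### One step of the factory -/

/-- The number of outcomes `0` among the first `N` outcomes of the `i`-th stream. -/
def countZeros (i : Fin n) (N : ℕ) (X : Sample n) : ℕ :=
  ∑ j ∈ Finset.range N, if X (i, j) = 0 then 1 else 0

theorem continuous_countZeros (i : Fin n) (N : ℕ) : Continuous (countZeros i N) :=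
  continuous_finsetSum _ fun j _ =>
    (continuous_of_discreteTopology (f := fun v : Fin 2 => if v = 0 then (1 : ℕ) else 0)).comp
      (continuous_apply (i, j))

theorem countZeros_le (i : Fin n) (N : ℕ) (X : Sample n) : countZeros i N X ≤ N := by
  refine (Finset.sum_le_card_nsmul _ _ 1 fun j _ => ?_).trans_eq (by simp)
  split_ifs <;> simp

/-- Weak law of large numbers, uniformly in `p`. -/
theorem quoinMeasure_countZeros_le (p : unitInterval) (i : Fin n) {N : ℕ} (hN : 0 < N) {δ : ℝ}
    (hδ : 0 < δ) :
    (quoinMeasure U p).real {X | N * δ ≤ |(countZeros i N X : ℝ) - N * bornProb (U i) p 0|} ≤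
      N / (4 * (N * δ) ^ 2) := by
  set Y : ℕ → Sample n → ℝ := fun j X => if X (i, j) = 0 then 1 else 0
  have hYm : ∀ j, Measurable (Y j) := fun j =>
    (measurable_of_countable (f := fun v : Fin 2 => if v = 0 then (1 : ℝ) else 0)).comp
      (measurable_pi_apply (i, j))
  have hYb : ∀ j X, Y j X ∈ Set.Icc (0 : ℝ) 1 := fun j X => by
    simp only [Y]; split_ifs <;> simp
  have hY2 : ∀ j, MemLp (Y j) 2 (quoinMeasure U p) := fun j =>
    MemLp.of_bound (hYm j).aestronglyMeasurable 1 (Eventually.of_forall fun X => by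
      rw [Real.norm_eq_abs, abs_of_nonneg (hYb j X).1]; exact (hYb j X).2)
  have hmean : ∀ j, ∫ X, Y j X ∂quoinMeasure U p = bornProb (U i) p 0 := by
    intro j
    have h : Y j = Set.indicator {X | X (i, j) = 0} 1 := by
      ext X; simp [Y, Set.indicator_apply]
    rw [h, integral_indicator_one (isClopen_measurableSet (isClopen_outcome (i, j) 0)),
      quoinMeasure_outcome]
  have hsum : (fun X => (countZeros i N X : ℝ)) = ∑ j ∈ Finset.range N, Y j := by
    ext X; simp [countZeros, Y]
  have hindep : iIndepFun Y (quoinMeasure U p) := by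
    have h := iIndepFun_infinitePi (P := fun ij : Fin n × ℕ => (outcomeLaw (U ij.1) p).toMeasure)
      (X := fun (_ : Fin n × ℕ) (v : Fin 2) => if v = 0 then (1 : ℝ) else 0)
      fun _ => measurable_of_countable _
    exact h.precomp (g := fun j : ℕ => (i, j)) fun a b hab => by simpa using hab
  have hvar : Var[fun X => (countZeros i N X : ℝ); quoinMeasure U p] ≤ N / 4 := by
    rw [hsum, IndepFun.variance_sum (fun j _ => hY2 j)
      fun j _ k _ hjk => hindep.indepFun hjk]
    refine (Finset.sum_le_card_nsmul _ _ (1 / 4) fun j _ => ?_).trans_eq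
      (by simp; ring)
    refine (variance_le_sq_of_bounded (Eventually.of_forall (hYb j)) (hYm j).aemeasurable).trans_eq
      (by norm_num)
  have hint : ∫ X, (countZeros i N X : ℝ) ∂quoinMeasure U p = N * bornProb (U i) p 0 := by
    rw [show (fun X => (countZeros i N X : ℝ)) = fun X => ∑ j ∈ Finset.range N, Y j X by
      rw [hsum]; ext X; simp, integral_finsetSum _ fun j _ => (hY2 j).integrable (by norm_num)]
    simp [hmean]
  have hmem : MemLp (fun X => (countZeros i N X : ℝ)) 2 (quoinMeasure U p) := by
    rw [hsum]; exact memLp_finsetSum' _ fun j _ => hY2 j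
  have hNδ : 0 < N * δ := by positivity
  have hcheb := meas_ge_le_variance_div_sq hmem hNδ
  rw [hint] at hcheb
  have h0 : 0 ≤ Var[fun X => (countZeros i N X : ℝ); quoinMeasure U p] / (N * δ) ^ 2 :=
    div_nonneg (variance_nonneg _ _) (by positivity)
  refine (ENNReal.toReal_le_of_le_ofReal h0 hcheb).trans ?_
  rw [← div_div]
  gcongr

/-- A clopen event that almost decides whether `f` is large or small at `p`. -/
theorem exists_isClopenProb_threshold {i : Fin n} (hi : U i = hGate 0) {f : unitInterval → ℝ}
    (hf : Continuous f) {ε : ℝ} (hε : 0 < ε) :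
    ∃ D : Set (Sample n), IsClopen D ∧ ∀ p,
      (f p ≤ 1 / 3 → (quoinMeasure U p).real D ≤ ε) ∧
      (2 / 3 ≤ f p → 1 - (quoinMeasure U p).real D ≤ ε) := by
  obtain ⟨δ, hδ, hfδ⟩ := Metric.uniformContinuous_iff.1
    (CompactSpace.uniformContinuous_of_continuous hf) (1 / 6) (by norm_num)
  obtain ⟨N, hN⟩ := exists_nat_gt (1 / (4 * δ ^ 2 * ε))
  have hN0 : (0 : ℝ) < N := lt_trans (by positivity) hN
  have hNε : (N : ℝ) / (4 * (N * δ) ^ 2) ≤ ε := by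
    rw [div_lt_iff₀ (by positivity)] at hN
    rw [div_le_iff₀ (by positivity)]
    nlinarith
  set avg : ℕ → unitInterval := fun m => Set.projIcc 0 1 zero_le_one ((m : ℝ) / N)
  set D : Set (Sample n) := countZeros i N ⁻¹' {m | 1 / 2 < f (avg m)}
  have hD : IsClopen D := (isClopen_discrete _).preimage (continuous_countZeros i N)
  have hlarge : ∀ (p : unitInterval) (X : Sample n),
      1 / 6 ≤ |f (avg (countZeros i N X)) - f p| →
      N * δ ≤ |(countZeros i N X : ℝ) - N * bornProb (U i) p 0| := by
    intro p X h
    by_contra! hlt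
    refine absurd (hfδ (a := avg (countZeros i N X)) (b := p) ?_) (not_lt.2 ?_)
    · have hle : (countZeros i N X : ℝ) ≤ N := by exact_mod_cast countZeros_le i N X
      rw [Subtype.dist_eq, Real.dist_eq]
      simp only [avg]
      rw [Set.projIcc_of_mem zero_le_one ⟨by positivity, (div_le_one hN0).2 hle⟩]
      rw [hi, bornProb_hGate_zero_zero] at hlt
      have e : (countZeros i N X : ℝ) / N - p = ((countZeros i N X : ℝ) - N * p) / N := by
        field_simp
      simp only
      rw [e, abs_div, abs_of_pos hN0, div_lt_iff₀ hN0]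
      linarith
    · rwa [Real.dist_eq]
  refine ⟨D, hD, fun p => ⟨fun hp => ?_, fun hp => ?_⟩⟩
  · refine le_trans (measureReal_mono fun X hX => hlarge p X ?_)
      ((quoinMeasure_countZeros_le U p i (Nat.cast_pos.1 hN0) hδ).trans hNε)
    have hX' : 1 / 2 < f (avg (countZeros i N X)) := hX
    exact le_trans (by linarith) (le_abs_self _)
  · rw [← quoinMeasure_compl U p hD]
    refine le_trans (measureReal_mono fun X hX => hlarge p X ?_)
      ((quoinMeasure_countZeros_le U p i (Nat.cast_pos.1 hN0) hδ).trans hNε)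
    have hX' : f (avg (countZeros i N X)) ≤ 1 / 2 := not_lt.1 hX
    exact le_trans (by linarith) (neg_le_abs _)

/-- The functions from which an elementary step of the factory can be split off: `q` and `r` have
the same zeros as `f` and `1 - f`, and are dominated by multiples of them. -/
structure Admissible (q r f : unitInterval → ℝ) : Prop where
  continuous : Continuous f
  bound : ∃ c > (0 : ℝ), ∀ p, c * q p ≤ f p ∧ c * r p ≤ 1 - f p
  pos_left : ∀ p, 0 < f p → 0 < q p
  pos_right : ∀ p, f p < 1 → 0 < r p

theorem exists_one_sub_pow_le_half {K : Set unitInterval} (hK : IsClosed K)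
    {g : unitInterval → ℝ} (hg : Continuous g) (h1 : ∀ p, g p ≤ 1) (hpos : ∀ p ∈ K, 0 < g p) :
    ∃ m : ℕ, ∀ p ∈ K, 1 / 2 ≤ 1 - (1 - g p) ^ m := by
  rcases K.eq_empty_or_nonempty with rfl | hne
  · exact ⟨0, by simp⟩
  obtain ⟨x, hx, hmin⟩ := hK.isCompact.exists_isMinOn hne hg.continuousOn
  obtain ⟨m, hm⟩ := exists_pow_lt_of_lt_one (show (0 : ℝ) < 1 / 2 by norm_num)
    (show 1 - g x < 1 by linarith [hpos x hx])
  refine ⟨m, fun p hp => ?_⟩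
  have hxp : g x ≤ g p := hmin hp
  have h : (1 - g p) ^ m ≤ (1 - g x) ^ m :=
    pow_le_pow_left₀ (by linarith [h1 p]) (by linarith) m
  linarith

theorem one_sub_one_sub_pow_le {x : ℝ} (hx : x ≤ 1) (m : ℕ) : 1 - (1 - x) ^ m ≤ m * x := by
  have h := one_add_mul_le_pow (a := -x) (by linarith) m
  rw [← sub_eq_add_neg] at h
  linarith

/-- One step of the factory. With a probability bounded below, either outcome is announced (on `A`
and `B`), and conditionally on no announcement there remains an admissible function `g`. -/
theorem Admissible.exists_step {i : Fin n} (hi : U i = hGate 0) {q r t f : unitInterval → ℝ}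
    (hq : IsClopenProb U q) (hr : IsClopenProb U r) (ht : IsClopenProb U t)
    (ht0 : ∀ p, 3 / 16 ≤ t p) (ht1 : ∀ p, t p ≤ 1 / 4) (hf : Admissible q r f) :
    ∃ (A B : Set (Sample n)) (g : unitInterval → ℝ), IsClopen A ∧ IsClopen B ∧ Disjoint A B ∧
      Admissible q r g ∧ ∀ p,
        3 / 64 ≤ (quoinMeasure U p).real A + (quoinMeasure U p).real B ∧
        f p = (quoinMeasure U p).real A +
          (1 - (quoinMeasure U p).real A - (quoinMeasure U p).real B) * g p := by
  obtain ⟨c, hc, hb⟩ := hf.bound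
  obtain ⟨m, hm⟩ := exists_one_sub_pow_le_half (K := {p | 1 / 3 ≤ f p})
    (isClosed_le continuous_const hf.continuous) hq.continuous hq.le_one
    fun p (hp : 1 / 3 ≤ f p) => hf.pos_left p (by linarith)
  obtain ⟨l, hl⟩ := exists_one_sub_pow_le_half (K := {p | f p ≤ 2 / 3})
    (isClosed_le hf.continuous continuous_const) hr.continuous hr.le_one
    fun p (hp : f p ≤ 2 / 3) => hf.pos_right p (by linarith)
  set ε : ℝ := min (1 / 2) (c / (2 * (m + l + 1)))
  have hε : 0 < ε := lt_min (by norm_num) (by positivity)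
  have hε2 : ε ≤ 1 / 2 := min_le_left _ _
  have hεc : ε * (m + l + 1) ≤ c / 2 := by
    have h : ε ≤ c / (2 * (m + l + 1)) := min_le_right _ _
    rwa [← div_div, le_div_iff₀ (by positivity)] at h
  have hεm : ε * m ≤ c / 2 := by nlinarith [mul_nonneg hε.le (Nat.cast_nonneg (α := ℝ) l)]
  have hεl : ε * l ≤ c / 2 := by nlinarith [mul_nonneg hε.le (Nat.cast_nonneg (α := ℝ) m)]
  obtain ⟨D, hD, hDε⟩ := exists_isClopenProb_threshold U hi hf.continuous hε
  have hqm : IsClopenProb U fun p => 1 - (1 - q p) ^ m := (hq.compl.pow m).compl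
  have hrl : IsClopenProb U fun p => 1 - (1 - r p) ^ l := (hr.compl.pow l).compl
  obtain ⟨A₀, hA₀, hPA₀⟩ := ht.mul hqm
  obtain ⟨B₀, hB₀, hPB₀⟩ := ht.mul hrl
  set A : Set (Sample n) := {X | block 0 X ∈ D} ∩ {X | block 1 X ∈ A₀}
  set B : Set (Sample n) := {X | block 0 X ∈ Dᶜ} ∩ {X | block 1 X ∈ B₀}
  have hA : IsClopen A := (isClopen_block_preimage hD 0).inter (isClopen_block_preimage hA₀ 1)
  have hB : IsClopen B := (isClopen_block_preimage hD.compl 0).inter (isClopen_block_preimage hB₀ 1)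
  set d : unitInterval → ℝ := fun p => (quoinMeasure U p).real D
  set a : unitInterval → ℝ := fun p => (quoinMeasure U p).real A
  set b : unitInterval → ℝ := fun p => (quoinMeasure U p).real B
  have ha : ∀ p, a p = d p * (t p * (1 - (1 - q p) ^ m)) := fun p => by
    simp only [a, d, A]; rw [quoinMeasure_block_inter U p hD hA₀, hPA₀]
  have hbb : ∀ p, b p = (1 - d p) * (t p * (1 - (1 - r p) ^ l)) := fun p => by
    simp only [b, d, B]; rw [quoinMeasure_block_inter U p hD.compl hB₀, hPB₀,
      quoinMeasure_compl U p hD]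
  have hd0 : ∀ p, 0 ≤ d p := fun p => measureReal_nonneg
  have hd1 : ∀ p, d p ≤ 1 := fun p => measureReal_le_one
  have ha0 : ∀ p, 0 ≤ a p := fun p => measureReal_nonneg
  have hb0 : ∀ p, 0 ≤ b p := fun p => measureReal_nonneg
  have hau : ∀ p, a p ≤ d p * (1 / 4) := fun p => by
    rw [ha]
    exact mul_le_mul_of_nonneg_left
      ((mul_le_of_le_one_right (ht.nonneg p) (hqm.le_one p)).trans (ht1 p)) (hd0 p)
  have hbu : ∀ p, b p ≤ (1 - d p) * (1 / 4) := fun p => by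
    rw [hbb]
    exact mul_le_mul_of_nonneg_left
      ((mul_le_of_le_one_right (ht.nonneg p) (hrl.le_one p)).trans (ht1 p))
      (sub_nonneg.2 (hd1 p))
  have hau' : ∀ p, a p ≤ d p * (m * q p) := fun p => by
    rw [ha]
    exact mul_le_mul_of_nonneg_left
      ((mul_le_of_le_one_left (hqm.nonneg p) (ht.le_one p)).trans
        (one_sub_one_sub_pow_le (hq.le_one p) m)) (hd0 p)
  have hbu' : ∀ p, b p ≤ (1 - d p) * (l * r p) := fun p => by
    rw [hbb]
    exact mul_le_mul_of_nonneg_left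
      ((mul_le_of_le_one_left (hrl.nonneg p) (ht.le_one p)).trans
        (one_sub_one_sub_pow_le (hr.le_one p) l)) (sub_nonneg.2 (hd1 p))
  have hal : ∀ p, 1 / 3 ≤ f p → d p * (3 / 32) ≤ a p := fun p hp => by
    rw [ha]
    refine mul_le_mul_of_nonneg_left ?_ (hd0 p)
    nlinarith [mul_le_mul (ht0 p) (hm p hp) (by norm_num) (ht.nonneg p)]
  have hbl : ∀ p, f p ≤ 2 / 3 → (1 - d p) * (3 / 32) ≤ b p := fun p hp => by
    rw [hbb]
    refine mul_le_mul_of_nonneg_left ?_ (sub_nonneg.2 (hd1 p))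
    nlinarith [mul_le_mul (ht0 p) (hl p hp) (by norm_num) (ht.nonneg p)]
  -- Some outcome is announced with probability at least `3 / 64`.
  have hsum : ∀ p, 3 / 64 ≤ a p + b p := by
    intro p
    rcases le_total (f p) (1 / 3) with h1 | h1
    · linarith [hbl p (by linarith), ha0 p, (hDε p).1 h1]
    rcases le_total (f p) (2 / 3) with h2 | h2
    · linarith [hbl p h2, hal p h1]
    · linarith [hal p h1, hb0 p, (hDε p).2 h2]
  set c' : ℝ := min (c / 2) (1 / 12)
  have hc' : 0 < c' := lt_min (by linarith) (by norm_num)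
  have hc1 : c' ≤ c / 2 := min_le_left _ _
  have hc2 : c' ≤ 1 / 12 := min_le_right _ _
  -- What remains of `f` after subtracting `a` still dominates a multiple of `q`.
  have hfa : ∀ p, c' * q p ≤ f p - a p := by
    intro p
    have hq0 := hq.nonneg p
    have hq1 := hq.le_one p
    rcases le_total (f p) (1 / 3) with h1 | h1
    · have h2 : d p * (m * q p) ≤ c / 2 * q p := by
        rw [← mul_assoc]
        exact mul_le_mul_of_nonneg_right ((mul_le_mul_of_nonneg_right ((hDε p).1 h1)
          (Nat.cast_nonneg m)).trans hεm) hq0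
      linarith [hau' p, (hb p).1, mul_le_mul_of_nonneg_right hc1 hq0]
    · nlinarith [hau p, hd1 p]
  have hfb : ∀ p, c' * r p ≤ 1 - f p - b p := by
    intro p
    have hr0 := hr.nonneg p
    have hr1 := hr.le_one p
    rcases le_total (f p) (2 / 3) with h1 | h1
    · nlinarith [hbu p, hd0 p]
    · have h2 : (1 - d p) * (l * r p) ≤ c / 2 * r p := by
        rw [← mul_assoc]
        exact mul_le_mul_of_nonneg_right ((mul_le_mul_of_nonneg_right ((hDε p).2 h1)
          (Nat.cast_nonneg l)).trans hεl) hr0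
      linarith [hbu' p, (hb p).2, mul_le_mul_of_nonneg_right hc1 hr0]
  have hpos : ∀ p, 0 < 1 - a p - b p := fun p => by linarith [hau p, hbu p]
  have hle : ∀ p, 1 - a p - b p ≤ 1 := fun p => by linarith [ha0 p, hb0 p]
  have hg1 : ∀ p, 1 - (f p - a p) / (1 - a p - b p) = (1 - f p - b p) / (1 - a p - b p) := by
    intro p
    have := (hpos p).ne'
    field_simp
    ring
  have hac : Continuous a := IsClopenProb.continuous (U := U) ⟨A, hA, fun _ => rfl⟩
  have hbc : Continuous b := IsClopenProb.continuous (U := U) ⟨B, hB, fun _ => rfl⟩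
  refine ⟨A, B, fun p => (f p - a p) / (1 - a p - b p), hA, hB, ?_, ⟨?_, ⟨c', hc', fun p => ?_⟩,
    fun p hp => ?_, fun p hp => ?_⟩, fun p => ⟨hsum p, ?_⟩⟩
  · exact Set.disjoint_left.2 fun X hXA hXB => hXB.1 hXA.1
  · exact (hf.continuous.sub hac).div ((continuous_const.sub hac).sub hbc) fun p => (hpos p).ne'
  · rw [hg1, le_div_iff₀ (hpos p), le_div_iff₀ (hpos p)]
    exact ⟨(mul_le_of_le_one_right (mul_nonneg hc'.le (hq.nonneg p)) (hle p)).trans (hfa p),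
      (mul_le_of_le_one_right (mul_nonneg hc'.le (hr.nonneg p)) (hle p)).trans (hfb p)⟩
  · have h := (div_pos_iff_of_pos_right (hpos p)).1 hp
    exact hf.pos_left p (by linarith [ha0 p])
  · rw [← sub_pos, hg1] at hp
    have h := (div_pos_iff_of_pos_right (hpos p)).1 hp
    exact hf.pos_right p (by linarith [hb0 p])
  · rw [mul_div_cancel₀ _ (hpos p).ne']
    ring

/-! ### Iterating the step -/

/-- The event that the blocks before the `k`-th lie in the sets `C j`, and the `k`-th block lies
in `A k`. -/
def firstHit (C A : ℕ → Set (Sample n)) (k : ℕ) : Set (Sample n) :=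
  {X | (∀ j < k, block j X ∈ C j) ∧ block k X ∈ A k}

theorem firstHit_eq (C A : ℕ → Set (Sample n)) (k : ℕ) :
    firstHit C A k = {X | ∀ j < k + 1, block j X ∈ Function.update C k (A k) j} := by
  ext X
  constructor
  · rintro ⟨h1, h2⟩ j hj
    rcases (Nat.lt_succ_iff_lt_or_eq.1 hj) with h | rfl
    · rw [Function.update_of_ne h.ne]; exact h1 j h
    · rwa [Function.update_self]
  · intro h
    refine ⟨fun j hj => ?_, ?_⟩
    · simpa [Function.update_of_ne hj.ne] using h j (hj.trans k.lt_succ_self)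
    · simpa using h k k.lt_succ_self

variable {C A B : ℕ → Set (Sample n)}

theorem isClopen_update (hC : ∀ k, IsClopen (C k)) (hA : ∀ k, IsClopen (A k)) (k j : ℕ) :
    IsClopen (Function.update C k (A k) j) := by
  rcases eq_or_ne j k with rfl | h
  · rw [Function.update_self]; exact hA j
  · rw [Function.update_of_ne h]; exact hC j

theorem isClopen_firstHit (hC : ∀ k, IsClopen (C k)) (hA : ∀ k, IsClopen (A k)) (k : ℕ) :
    IsClopen (firstHit C A k) := by
  have h : firstHit C A k =
      ⋂ j ∈ Finset.range (k + 1), {X | block j X ∈ Function.update C k (A k) j} := by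
    rw [firstHit_eq]; ext X; simp
  rw [h]
  exact isClopen_biInter_finset fun j _ => isClopen_block_preimage (isClopen_update hC hA k j) j

theorem quoinMeasure_firstHit (p : unitInterval) (hC : ∀ k, IsClopen (C k))
    (hA : ∀ k, IsClopen (A k)) (k : ℕ) :
    (quoinMeasure U p).real (firstHit C A k) =
      (∏ j ∈ Finset.range k, (quoinMeasure U p).real (C j)) * (quoinMeasure U p).real (A k) := by
  rw [firstHit_eq, quoinMeasure_forall_block U p (isClopen_update hC hA k),
    Finset.prod_range_succ, Function.update_self]
  congr 1
  exact Finset.prod_congr rfl fun j hj => by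
    rw [Function.update_of_ne (Finset.mem_range.1 hj).ne]

theorem disjoint_firstHit_of_lt (hCB : ∀ k, Disjoint (C k) (B k)) {k l : ℕ} (h : k < l) :
    Disjoint (firstHit C B k) (firstHit C A l) :=
  Set.disjoint_left.2 fun _ hk hl => Set.disjoint_left.1 (hCB k) (hl.1 k h) hk.2

theorem disjoint_iUnion_firstHit (hCA : ∀ k, Disjoint (C k) (A k))
    (hCB : ∀ k, Disjoint (C k) (B k)) (hAB : ∀ k, Disjoint (A k) (B k)) :
    Disjoint (⋃ k, firstHit C A k) (⋃ k, firstHit C B k) := by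
  rw [Set.disjoint_iUnion_left]
  intro k
  rw [Set.disjoint_iUnion_right]
  intro l
  rcases lt_trichotomy k l with h | rfl | h
  · exact disjoint_firstHit_of_lt hCA h
  · exact Set.disjoint_left.2 fun _ h1 h2 => Set.disjoint_left.1 (hAB k) h1.2 h2.2
  · exact (disjoint_firstHit_of_lt hCB h).symm

/-- If `g k = P(A k) + P(C k) g (k + 1)` for all `k`, then the process that announces an outcome at
the first block `k` lying in `A k`, and continues only as long as the blocks lie in `C k`, announces
it with probability at least `g 0`, provided that it stops almost surely. -/
theorem le_quoinMeasure_iUnion_firstHit (p : unitInterval) (hC : ∀ k, IsClopen (C k))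
    (hA : ∀ k, IsClopen (A k)) (hCA : ∀ k, Disjoint (C k) (A k)) {g : ℕ → ℝ} {ρ : ℝ}
    (hρ : ρ < 1) (hCρ : ∀ k, (quoinMeasure U p).real (C k) ≤ ρ) (hg : ∀ k, g k ≤ 1)
    (hrec : ∀ k, g k = (quoinMeasure U p).real (A k) + (quoinMeasure U p).real (C k) * g (k + 1)) :
    g 0 ≤ (quoinMeasure U p).real (⋃ k, firstHit C A k) := by
  have hρ0 : 0 ≤ ρ := le_trans measureReal_nonneg (hCρ 0)
  have hsum : ∀ K, ∑ k ∈ Finset.range K, (quoinMeasure U p).real (firstHit C A k) =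
      g 0 - (∏ j ∈ Finset.range K, (quoinMeasure U p).real (C j)) * g K := by
    intro K
    induction K with
    | zero => simp
    | succ K ih =>
      rw [Finset.sum_range_succ, ih, quoinMeasure_firstHit U p hC hA, Finset.prod_range_succ,
        hrec K]
      ring
  have hbound : ∀ K, g 0 - ρ ^ K ≤ (quoinMeasure U p).real (⋃ k, firstHit C A k) := by
    intro K
    have hprod : ∏ j ∈ Finset.range K, (quoinMeasure U p).real (C j) ≤ ρ ^ K := by
      refine (Finset.prod_le_prod (fun _ _ => measureReal_nonneg) fun j _ => hCρ j).trans_eq ?_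
      simp
    have hprod0 : 0 ≤ ∏ j ∈ Finset.range K, (quoinMeasure U p).real (C j) :=
      Finset.prod_nonneg fun _ _ => measureReal_nonneg
    have h1 : g 0 - ρ ^ K ≤
        ∑ k ∈ Finset.range K, (quoinMeasure U p).real (firstHit C A k) := by
      rw [hsum]
      linarith [mul_le_of_le_one_right hprod0 (hg K)]
    refine h1.trans ?_
    rw [← measureReal_biUnion_finset (fun k _ l _ hkl => ?_)
      fun k _ => isClopen_measurableSet (isClopen_firstHit hC hA k)]
    · exact measureReal_mono (Set.iUnion₂_subset fun k _ => Set.subset_iUnion _ k)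
    · rcases hkl.lt_or_gt with h | h
      · exact disjoint_firstHit_of_lt hCA h
      · exact (disjoint_firstHit_of_lt hCA h).symm
  have hlim : Tendsto (fun K : ℕ => g 0 - ρ ^ K) atTop (𝓝 (g 0 - 0)) :=
    tendsto_const_nhds.sub (tendsto_pow_atTop_nhds_zero_of_lt_one hρ0 hρ)
  rw [sub_zero] at hlim
  exact le_of_tendsto' hlim hbound

/-- Iterating the elementary step on successive blocks announces one of the two outcomes almost
surely, and the first one with probability `f p`. -/
theorem Admissible.exists_isOpen {i : Fin n} (hi : U i = hGate 0) {q r t f : unitInterval → ℝ}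
    (hq : IsClopenProb U q) (hr : IsClopenProb U r) (ht : IsClopenProb U t)
    (ht0 : ∀ p, 3 / 16 ≤ t p) (ht1 : ∀ p, t p ≤ 1 / 4) (hf : Admissible q r f) :
    ∃ S T : Set (Sample n), IsOpen S ∧ IsOpen T ∧ Disjoint S T ∧ ∀ p,
      (quoinMeasure U p).real S = f p ∧ (quoinMeasure U p).real T = 1 - f p := by
  have hstep : ∀ F : {f // Admissible q r f}, ∃ (A B : Set (Sample n))
      (G : {f // Admissible q r f}), IsClopen A ∧ IsClopen B ∧ Disjoint A B ∧ ∀ p,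
        3 / 64 ≤ (quoinMeasure U p).real A + (quoinMeasure U p).real B ∧
        F.1 p = (quoinMeasure U p).real A +
          (1 - (quoinMeasure U p).real A - (quoinMeasure U p).real B) * G.1 p := by
    rintro ⟨F, hF⟩
    obtain ⟨A, B, g, hA, hB, hAB, hg, h⟩ := hF.exists_step U hi hq hr ht ht0 ht1
    exact ⟨A, B, ⟨g, hg⟩, hA, hB, hAB, h⟩
  choose A B G hA hB hAB hG using hstep
  set F : ℕ → {f // Admissible q r f} := fun k => G^[k] ⟨f, hf⟩
  have hF : ∀ k, G (F k) = F (k + 1) := fun k => (Function.iterate_succ_apply' G k _).symm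
  set C : ℕ → Set (Sample n) := fun k => (A (F k) ∪ B (F k))ᶜ
  have hC : ∀ k, IsClopen (C k) := fun k => ((hA _).union (hB _)).compl
  have hCA : ∀ k, Disjoint (C k) (A (F k)) := fun k =>
    Set.disjoint_left.2 fun _ h1 h2 => h1 (Or.inl h2)
  have hCB : ∀ k, Disjoint (C k) (B (F k)) := fun k =>
    Set.disjoint_left.2 fun _ h1 h2 => h1 (Or.inr h2)
  have hPC : ∀ p k, (quoinMeasure U p).real (C k) =
      1 - (quoinMeasure U p).real (A (F k)) - (quoinMeasure U p).real (B (F k)) := by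
    intro p k
    rw [quoinMeasure_compl U p ((hA _).union (hB _)),
      measureReal_union (hAB _) (isClopen_measurableSet (hB _))]
    ring
  have hCρ : ∀ p k, (quoinMeasure U p).real (C k) ≤ 61 / 64 := fun p k => by
    rw [hPC]; linarith [(hG (F k) p).1]
  have hrec : ∀ p k, (F k).1 p = (quoinMeasure U p).real (A (F k)) +
      (quoinMeasure U p).real (C k) * (F (k + 1)).1 p := fun p k => by
    rw [hPC, ← hF]; exact (hG (F k) p).2
  have h01 : ∀ p k, 0 ≤ (F k).1 p ∧ (F k).1 p ≤ 1 := by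
    intro p k
    obtain ⟨c, hc, h⟩ := (F k).2.bound
    have h1 := mul_nonneg hc.le (hq.nonneg p)
    have h2 := mul_nonneg hc.le (hr.nonneg p)
    constructor <;> linarith [h p]
  set S : Set (Sample n) := ⋃ k, firstHit C (fun k => A (F k)) k
  set T : Set (Sample n) := ⋃ k, firstHit C (fun k => B (F k)) k
  have hST : Disjoint S T := disjoint_iUnion_firstHit hCA hCB fun k => hAB (F k)
  have hS : IsOpen S := isOpen_iUnion fun k => (isClopen_firstHit hC (fun k => hA (F k)) k).isOpen
  have hT : IsOpen T := isOpen_iUnion fun k => (isClopen_firstHit hC (fun k => hB (F k)) k).isOpen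
  refine ⟨S, T, hS, hT, hST, fun p => ?_⟩
  have h1 : f p ≤ (quoinMeasure U p).real S :=
    le_quoinMeasure_iUnion_firstHit U p hC (fun k => hA (F k)) hCA (g := fun k => (F k).1 p)
      (by norm_num) (hCρ p) (fun k => (h01 p k).2) (hrec p)
  have h2 : 1 - f p ≤ (quoinMeasure U p).real T :=
    le_quoinMeasure_iUnion_firstHit U p hC (fun k => hB (F k)) hCB (g := fun k => 1 - (F k).1 p)
      (by norm_num) (hCρ p) (fun k => by linarith [(h01 p k).1]) fun k => by
        have h := hrec p k
        rw [hPC] at h ⊢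
        linarith
  have h3 : (quoinMeasure U p).real S + (quoinMeasure U p).real T ≤ 1 := by
    rw [← measureReal_union hST hT.measurableSet]
    exact measureReal_le_one
  constructor <;> linarith

theorem discernible_of_isOpen {P : Measure (Sample n)} [IsProbabilityMeasure P]
    {S T : Set (Sample n)} (hS : IsOpen S) (hT : IsOpen T) (hST : Disjoint S T)
    (h : P.real S + P.real T = 1) : Discernible P S := by
  refine le_antisymm ?_ ?_
  · rw [← measure_union (disjoint_compl_right.mono interior_subset interior_subset)
      isOpen_interior.measurableSet]
    exact prob_le_one
  · rw [hS.interior_eq, ← ENNReal.ofReal_one, ← h, ENNReal.ofReal_add measureReal_nonneg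
      measureReal_nonneg, ofReal_measureReal, ofReal_measureReal]
    exact add_le_add_right (measure_mono (interior_maximal hST.subset_compl_left hT)) _

theorem qConstructible_of_trivial {𝒰 : Set (Matrix.unitaryGroup (Fin 2) ℂ)}
    {f : unitInterval → unitInterval} (h : (∀ p, f p = 0) ∨ (∀ p, f p = 1)) :
    QConstructible 𝒰 f := by
  rcases h with h | h
  · exact ⟨0, Fin.elim0, ∅, fun i => i.elim0, fun p => ⟨nullMeasurableSet_empty,
      by simp [Discernible], by simp [h]⟩⟩
  · exact ⟨0, Fin.elim0, Set.univ, fun i => i.elim0, fun p => ⟨nullMeasurableSet_univ,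
      by simp [Discernible], by simp [h]⟩⟩

theorem qConstructible_of_isSPB {f : unitInterval → unitInterval} (hf : IsSPB f) :
    QConstructible (Set.range hGate) f := by
  classical
  have hfc : Continuous fun p => (f p : ℝ) := continuous_subtype_val.comp hf.continuous
  have hf0 : ∀ p, 0 ≤ (f p : ℝ) := fun p => (f p).2.1
  have hf1 : ∀ p, 0 ≤ 1 - (f p : ℝ) := fun p => sub_nonneg.2 (f p).2.2
  have eq_zero : ∀ z, (f z : ℝ) = 0 → f z = 0 := fun z hz => Subtype.ext hz
  have eq_one : ∀ w, 1 - (f w : ℝ) = 0 → f w = 1 := fun w hw =>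
    Subtype.ext (sub_eq_zero.1 hw).symm
  have hZ : {z | (f z : ℝ) = 0}.Finite := hf.finite_zeros.subset eq_zero
  have hW : {w | 1 - (f w : ℝ) = 0}.Finite := hf.finite_ones.subset eq_one
  obtain ⟨k, c, hc, hk⟩ := exists_mul_prod_zeroCoin_le hfc hf0 hZ
    fun z hz => hf.zero_bound z (eq_zero z hz)
  obtain ⟨l, c', hc', hl⟩ := exists_mul_prod_zeroCoin_le
    (f := fun p => 1 - (f p : ℝ)) (continuous_const.sub hfc) hf1 hW fun w hw => by
      obtain ⟨c, hc, δ, hδ, k, h⟩ := hf.one_bound w (eq_one w hw)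
      exact ⟨c, hc, δ, hδ, k, fun p hp => by linarith [h p hp]⟩
  obtain ⟨half, hhalf⟩ : ∃ a : unitInterval, (a : ℝ) = 1 / 2 := ⟨⟨1 / 2, by norm_num⟩, rfl⟩
  set gates : Finset unitInterval :=
    {0, half} ∪ (hZ.toFinset ∪ hW.toFinset).image unitInterval.symm
  set U : Fin gates.card → Matrix.unitaryGroup (Fin 2) ℂ := fun i => hGate (gates.equivFin.symm i)
  have hU : ∀ a ∈ gates, ∃ i, U i = hGate a := fun a ha =>
    ⟨gates.equivFin ⟨a, ha⟩, by simp [U]⟩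
  have hborn : ∀ a ∈ gates, ∀ v, IsClopenProb U fun p => bornProb (hGate a) p v := by
    intro a ha v
    obtain ⟨i, hi⟩ := hU a ha
    rw [← hi]
    exact isClopenProb_bornProb U i v
  have hcoin : ∀ z ∈ hZ.toFinset ∪ hW.toFinset, IsClopenProb U (zeroCoin z) := fun z hz =>
    hborn _ (Finset.mem_union_right _ (Finset.mem_image_of_mem _ hz)) 1
  have hq : IsClopenProb U fun p => ∏ z ∈ hZ.toFinset, zeroCoin z p ^ (2 * k z) :=
    IsClopenProb.prod _ fun z hz => (hcoin z (Finset.mem_union_left _ hz)).pow _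
  have hr : IsClopenProb U fun p => ∏ w ∈ hW.toFinset, zeroCoin w p ^ (2 * l w) :=
    IsClopenProb.prod _ fun w hw => (hcoin w (Finset.mem_union_right _ hw)).pow _
  have h0 : (0 : unitInterval) ∈ gates := Finset.mem_union_left _ (by simp)
  have h1 : half ∈ gates := Finset.mem_union_left _ (by simp)
  have hs := fun p => bornProb_hGate_half p hhalf
  have hp := hborn 0 h0 0
  have hh := hborn half h1 0
  -- With `u = p (1 - p)` this is `u + (1/4 - u) - u (1/4 - u)`, which lies in `[3/16, 1/4]`.
  have ht := ((hp.mul hp.compl).compl.mul (hh.mul hh.compl).compl).compl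
  simp only [bornProb_hGate_zero_zero, hs] at ht
  have hu0 : ∀ p : unitInterval, 0 ≤ (p : ℝ) * (1 - p) := fun p =>
    mul_nonneg p.2.1 (sub_nonneg.2 p.2.2)
  have hu1 : ∀ p : unitInterval, (p : ℝ) * (1 - p) ≤ 1 / 4 := fun p => by
    nlinarith [sq_nonneg ((p : ℝ) - 1 / 2)]
  have hadm : Admissible (fun p => ∏ z ∈ hZ.toFinset, zeroCoin z p ^ (2 * k z))
      (fun p => ∏ w ∈ hW.toFinset, zeroCoin w p ^ (2 * l w)) fun p => (f p : ℝ) := by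
    refine ⟨hfc, ⟨min c c', lt_min hc hc', fun p => ⟨?_, ?_⟩⟩, fun p hp => ?_, fun p hp => ?_⟩
    · exact (mul_le_mul_of_nonneg_right (min_le_left _ _) (hq.nonneg p)).trans (hk p)
    · exact (mul_le_mul_of_nonneg_right (min_le_right _ _) (hr.nonneg p)).trans (hl p)
    · refine Finset.prod_pos fun z hz => pow_pos (zeroCoin_pos ?_) _
      rintro rfl
      exact hp.ne' (hZ.mem_toFinset.1 hz)
    · refine Finset.prod_pos fun w hw => pow_pos (zeroCoin_pos ?_) _
      rintro rfl
      exact (sub_pos.2 hp).ne' (hW.mem_toFinset.1 hw)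
  obtain ⟨i, hi⟩ := hU 0 h0
  obtain ⟨S, T, hS, hT, hST, h⟩ := hadm.exists_isOpen U hi hq hr ht
    (fun p => by nlinarith [hu0 p, hu1 p, sq_nonneg ((p : ℝ) * (1 - p) - 1 / 8)])
    fun p => by nlinarith [mul_nonneg (hu0 p) (sub_nonneg.2 (hu1 p))]
  refine ⟨gates.card, U, S, fun i => Set.mem_range_self _, fun p =>
    ⟨hS.measurableSet.nullMeasurableSet, discernible_of_isOpen hS hT hST ?_, (h p).1⟩⟩
  rw [(h p).1, (h p).2]
  ring

theorem QConstructible.mono {𝒰 𝒱 : Set (Matrix.unitaryGroup (Fin 2) ℂ)} (h : 𝒰 ⊆ 𝒱)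
    {f : unitInterval → unitInterval} (hf : QConstructible 𝒰 f) : QConstructible 𝒱 f := by
  obtain ⟨n, U, S, hU, hS⟩ := hf
  exact ⟨n, U, S, fun i => h (hU i), hS⟩

end QuantumBernoulli
end

theorem theorem1 (f : unitInterval → unitInterval) :
    (QuantumBernoulli.QConstructible Set.univ f ↔
      (QuantumBernoulli.IsSPB f ∨ (∀ p, f p = 0) ∨ (∀ p, f p = 1))) ∧
    (QuantumBernoulli.QConstructible (Set.range QuantumBernoulli.hGate) f ↔
      (QuantumBernoulli.IsSPB f ∨ (∀ p, f p = 0) ∨ (∀ p, f p = 1))) := by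
  have hback : (QuantumBernoulli.IsSPB f ∨ (∀ p, f p = 0) ∨ (∀ p, f p = 1)) →
      QuantumBernoulli.QConstructible (Set.range QuantumBernoulli.hGate) f := by
    rintro (h | h)
    · exact QuantumBernoulli.qConstructible_of_isSPB h
    · exact QuantumBernoulli.qConstructible_of_trivial h
  exact ⟨⟨QuantumBernoulli.isSPB_or_trivial_of_qConstructible,
    fun h => (hback h).mono (Set.subset_univ _)⟩,
    QuantumBernoulli.isSPB_or_trivial_of_qConstructible, hback⟩
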